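/- Let $V=\bigoplus_{n=0}^{\infty}V_n$ be a vertex operator algebra over $\mathbb{C}$, with vacuum $\mathbf 1\in V_0$, conformal vector $\omega\in V_2$ and vertex operators $Y(a,z)=\sum_{n\in\mathbb Z}a_nz^{-n-1}$. Let $C_2(V)=\mathrm{span}\{a_{-2}b : a,b\in V\}$; Zhu's $C_2$-algebra is the commutative associative algebra $V/C_2(V)$ with product $(a+C_2(V))(b+C_2(V))=a_{-1}b+C_2(V)$ and unit $\mathbf 1+C_2(V)$. Let $$O(V)=\mathrm{span}\Big\{\sum_{j\ge 0}\binom{n}{j}a_{j-2}b : n\ge 0,\ a\in V_n,\ b\in V\Big\};$$ Zhu's algebra is the associative algebra $A(V)=V/O(V)$ with unit $\mathbf 1+O(V)$ and product induced by $a\ast b=\sum_{j\ge 0}\binom{n}{j}a_{j-1}b$ for $a\in V_n$, $b\in V$ (extended linearly in $a$). Let $A(V)_n$ be the image of $\bigoplus_{i=0}^{n}V_i$ in $A(V)$ and $A(V)_{-1}=0$. This is an algebra filtration; let $\mathrm{gr}\,A(V)=\bigoplus_{n\ge 0}A(V)_n/A(V)_{n-1}$ be the associated graded algebra, with product $\bar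 x\ast\bar y=\overline{x\ast y}$. For $x\in V_n$ let $\bar x\in A(V)_n/A(V)_{n-1}$ denote the class of $x+O(V)$. Then $\mathrm{gr}\,A(V)$ is commutative, with $\bar a\ast\bar b=\overline{a_{-1}b}\in A(V)_{m+n}/A(V)_{m+n-1}$ for all $a\in V_m$, $b\in V_n$, and there is a well-defined surjective homomorphism of commutative $\mathbb{C}$-algebras $$\phi: V/C_2(V)\to \mathrm{gr}\,A(V),\qquad \phi(x+C_2(V))=\bar x\in A(V)_n/A(V)_{n-1}\quad\text{for } x\in V_n,\ n\ge 0.$$ -/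

import Mathlib

/-- For `Y(a, z) = ∑ a_n z ^ (-n - 1)`, the map `(a, b) ↦ a_n b`. -/
noncomputable def fieldMode {V : Type*} [AddCommGroup V] [Module ℂ V]
    (Y : V →ₗ[ℂ] VertexOperator ℂ V) (n : ℤ) : V →ₗ[ℂ] V →ₗ[ℂ] V :=
  LinearMap.proj n ∘ₗ VertexOperator.ncoeff ∘ₗ Y

/-- A vertex operator algebra `V = ⨁_{n ≥ 0} V_n` over `ℂ`.  The coefficient of `z ^ (-n - 1)` in
`Y(a, z) b`, i.e. the `n`-th mode `a_n b`, is `fieldMode Y n a b`; that `a_n b = 0` for `n` large is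
part of the type `VertexOperator ℂ V`.  Hence the sums `∑ᶠ` below have finite support. -/
class VertexOperatorAlgebra (V : Type*) [AddCommGroup V] [Module ℂ V] where
  /-- The state-field correspondence `a ↦ Y(a, z)`. -/
  Y : V →ₗ[ℂ] VertexOperator ℂ V
  /-- The vacuum vector. -/
  vac : V
  /-- The conformal vector. -/
  conf : V
  /-- The central charge. -/
  centralCharge : ℂ
  /-- The homogeneous subspaces `V_n`. -/
  wtSpace : ℕ → Submodule ℂ V
  isInternal_wtSpace : DirectSum.IsInternal wtSpace
  finiteDimensional_wtSpace : ∀ n, FiniteDimensional ℂ (wtSpace n)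
  vac_mem : vac ∈ wtSpace 0
  conf_mem : conf ∈ wtSpace 2
  /-- `Y(𝟏, z) = id`. -/
  vacuum : ∀ (n : ℤ) (b : V), fieldMode Y n vac b = if n = -1 then b else 0
  /-- `Y(a, z) 𝟏 ∈ a + z V[[z]]`. -/
  creation : ∀ a : V, fieldMode Y (-1) a vac = a
  creation_nonneg : ∀ (a : V) (n : ℕ), fieldMode Y (n : ℤ) a vac = 0
  /-- The Jacobi identity, in component form (the Borcherds identity). -/
  borcherds : ∀ (a b c : V) (l m n : ℤ),
    ∑ᶠ j : ℕ, Ring.choose m j • fieldMode Y (m + n - j) (fieldMode Y (l + j) a b) c =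
      ∑ᶠ j : ℕ, ((-1) ^ j * Ring.choose l j) •
        (fieldMode Y (m + l - j) a (fieldMode Y (n + j) b c) -
          l.negOnePow • fieldMode Y (n + l - j) b (fieldMode Y (m + j) a c))
  /-- The Virasoro relations for `L(n) = ω_{n+1}`. -/
  virasoro : ∀ (m n : ℤ) (b : V),
    fieldMode Y (m + 1) conf (fieldMode Y (n + 1) conf b) -
        fieldMode Y (n + 1) conf (fieldMode Y (m + 1) conf b) =
      (m - n) • fieldMode Y (m + n + 1) conf b +
        if m + n = 0 then (((m : ℂ) ^ 3 - m) / 12 * centralCharge) • b else 0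
  /-- `V_n` is the space of vectors of `L(0)`-weight `n`. -/
  L_zero : ∀ (n : ℕ), ∀ b ∈ wtSpace n, fieldMode Y 1 conf b = (n : ℂ) • b
  /-- `Y(L(-1) a, z) = d/dz Y(a, z)`. -/
  L_neg_one : ∀ (a b : V) (n : ℤ),
    fieldMode Y n (fieldMode Y 0 conf a) b = (-n) • fieldMode Y (n - 1) a b

namespace VertexOperatorAlgebra

open scoped DirectSum

variable {V : Type*} [AddCommGroup V] [Module ℂ V] [VertexOperatorAlgebra V]

/-- The product `a_n b`, as a bilinear map of `a` and `b`. -/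
noncomputable def mode (n : ℤ) : V →ₗ[ℂ] V →ₗ[ℂ] V := fieldMode Y n

theorem mode_apply (n : ℤ) (a b : V) : mode n a b = fieldMode Y n a b := rfl

theorem exists_mode_eq_zero (a b : V) : ∃ N : ℕ, ∀ n : ℤ, (N : ℤ) ≤ n → mode n a b = 0 := by
  refine ⟨(-(HahnSeries.order ((HahnModule.of ℂ).symm (Y a b)))).toNat, fun n hn => ?_⟩
  apply VertexOperator.ncoeff_eq_zero_of_lt_order
  omega

theorem borcherds_range (a b c : V) (l m n : ℤ) (N : ℕ)
    (h1 : ∀ j : ℕ, N ≤ j → mode (l + j) a b = 0)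
    (h2 : ∀ j : ℕ, N ≤ j → mode (n + j) b c = 0)
    (h3 : ∀ j : ℕ, N ≤ j → mode (m + j) a c = 0) :
    ∑ j ∈ Finset.range N, (Ring.choose m j) • mode (m + n - j) (mode (l + j) a b) c =
      ∑ j ∈ Finset.range N, ((-1) ^ j * Ring.choose l j) •
        (mode (m + l - j) a (mode (n + j) b c) -
          l.negOnePow • mode (n + l - j) b (mode (m + j) a c)) := by
  have h := borcherds a b c l m n
  simp only [← mode_apply] at h
  rw [finsum_eq_sum_of_support_subset (s := Finset.range N),
    finsum_eq_sum_of_support_subset (s := Finset.range N)] at h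
  · exact h
  · intro j hj
    by_contra hN
    simp only [Finset.coe_range, Set.mem_Iio, not_lt] at hN
    simp [h2 j hN, h3 j hN] at hj
  · intro j hj
    by_contra hN
    simp only [Finset.coe_range, Set.mem_Iio, not_lt] at hN
    simp [h1 j hN] at hj

theorem exists_bound (a b c : V) (l m n : ℤ) : ∃ N : ℕ,
    (∀ j : ℕ, N ≤ j → mode (l + j) a b = 0) ∧ (∀ j : ℕ, N ≤ j → mode (n + j) b c = 0) ∧
    (∀ j : ℕ, N ≤ j → mode (m + j) a c = 0) := by
  obtain ⟨N1, h1⟩ := exists_mode_eq_zero a b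
  obtain ⟨N2, h2⟩ := exists_mode_eq_zero b c
  obtain ⟨N3, h3⟩ := exists_mode_eq_zero a c
  refine ⟨N1 + N2 + N3 + l.natAbs + m.natAbs + n.natAbs, ?_, ?_, ?_⟩ <;> intro j hj
  · exact h1 _ (by omega)
  · exact h2 _ (by omega)
  · exact h3 _ (by omega)

theorem mode_vac_left (n : ℤ) (b : V) : mode n vac b = if n = -1 then b else 0 := vacuum n b

theorem mode_vac_right (a : V) : mode (-1) a vac = a := creation a

theorem mode_vac_right_nonneg (a : V) {n : ℤ} (hn : 0 ≤ n) : mode n a vac = 0 := by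
  lift n to ℕ using hn
  exact creation_nonneg a n

/-! ### Homogeneous components -/

theorem mode_zero_conf (a b : V) (n : ℤ) :
    mode n (mode 0 conf a) b = (-n) • mode (n - 1) a b := L_neg_one a b n

theorem mode_one_conf {n : ℕ} {b : V} (hb : b ∈ wtSpace n) : mode 1 conf b = (n : ℂ) • b :=
  L_zero n b hb

theorem decompose_L_zero (x : ⨁ n, wtSpace (V := V) n) :
    ∃ y : ⨁ n, wtSpace (V := V) n, mode 1 conf (DirectSum.coeLinearMap wtSpace x) =
      DirectSum.coeLinearMap wtSpace y ∧ ∀ n, y n = (n : ℂ) • x n := by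
  induction x using DirectSum.induction_on with
  | zero => exact ⟨0, by simp, by simp⟩
  | of i x =>
    refine ⟨(i : ℂ) • DirectSum.of (fun n => wtSpace (V := V) n) i x, ?_, ?_⟩
    · rw [map_smul, DirectSum.coeLinearMap_of, mode_one_conf x.2]
    · intro n
      rw [DirectSum.smul_apply]
      by_cases h : i = n
      · subst h; rfl
      · rw [DirectSum.of_eq_of_ne _ _ _ (Ne.symm h)]; simp
  | add x x' hx hx' =>
    obtain ⟨y, hy, hy'⟩ := hx
    obtain ⟨z, hz, hz'⟩ := hx'
    refine ⟨y + z, by rw [map_add, map_add, map_add, hy, hz], fun n => ?_⟩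
    rw [DirectSum.add_apply, DirectSum.add_apply, hy', hz', smul_add]

theorem mem_wtSpace_of_eigen {k : ℤ} {v : V} (hv : mode 1 conf v = (k : ℂ) • v) :
    (∀ n : ℕ, (n : ℤ) = k → v ∈ wtSpace n) ∧ (k < 0 → v = 0) := by
  obtain ⟨x, rfl⟩ := (isInternal_wtSpace (V := V)).2 v
  obtain ⟨y, hy, hy'⟩ := decompose_L_zero x
  change mode 1 conf (DirectSum.coeLinearMap wtSpace x) = _ • DirectSum.coeLinearMap wtSpace x at hv
  rw [hy, ← map_smul] at hv
  have hxy := (isInternal_wtSpace (V := V)).1 hv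
  have key : ∀ n : ℕ, (n : ℤ) ≠ k → x n = 0 := by
    intro n hn
    have := DFunLike.congr_fun hxy n
    rw [hy', DirectSum.smul_apply] at this
    have h2 : ((n : ℂ) - k) • x n = 0 := by rw [sub_smul, this, sub_self]
    refine (smul_eq_zero.1 h2).resolve_left fun h3 => hn ?_
    have : ((n : ℤ) : ℂ) = (k : ℂ) := by
      rw [Int.cast_natCast]; exact sub_eq_zero.1 h3
    exact_mod_cast this
  constructor
  · intro n hn
    have : x = DirectSum.of (fun n => wtSpace (V := V) n) n (x n) := by
      refine DFinsupp.ext fun i => ?_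
      by_cases h : i = n
      · subst h; rw [DirectSum.of_eq_same]
      · rw [DirectSum.of_eq_of_ne _ _ _ h, key i (by omega)]
    rw [this]
    rw [DirectSum.coeAddMonoidHom_of]
    exact (x n).2
  · intro hk
    have : x = 0 := DFinsupp.ext fun i => key i (by omega)
    rw [this, map_zero]

theorem L_zero_mode {p q : ℕ} {a b : V} (ha : a ∈ wtSpace p) (hb : b ∈ wtSpace q) (n : ℤ) :
    mode 1 conf (mode n a b) = ((p + q - n - 1 : ℤ) : ℂ) • mode n a b := by
  obtain ⟨N, h1, h2, h3⟩ := exists_bound (conf : V) a b 0 1 n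
  have h := borcherds_range (conf : V) a b 0 1 n (N + 2) (fun j hj => h1 j (by omega))
    (fun j hj => h2 j (by omega)) (fun j hj => h3 j (by omega))
  rw [Finset.sum_range_succ', Finset.sum_range_succ', Finset.sum_range_succ',
    Finset.sum_eq_zero, Finset.sum_eq_zero] at h
  · simp only [Ring.choose_zero_right, Ring.choose_one_right, zero_add, Nat.cast_zero,
      Nat.cast_one, pow_zero, Int.negOnePow_zero, add_zero, sub_zero, one_smul, mul_one] at h
    rw [mode_one_conf ha, mode_one_conf hb, mode_zero_conf] at h
    have e : (1 : ℤ) + n - 1 = n := by ring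
    have e' : (1 : ℤ) + n = n + 1 := by ring
    rw [e, e'] at h
    simp only [map_smul, LinearMap.smul_apply] at h
    rw [eq_comm, sub_eq_iff_eq_add] at h
    rw [h, ← Int.cast_smul_eq_zsmul ℂ]
    push_cast
    module
  · intro j _
    have : Ring.choose (0 : ℤ) (j + 1) = 0 := Ring.choose_zero_pos ℤ (by omega)
    simp [this]
  · intro j _
    have : Ring.choose (1 : ℤ) (j + 1 + 1) = 0 := by
      rw [show (1 : ℤ) = ((1 : ℕ) : ℤ) by rfl, Ring.choose_natCast]
      simp [Nat.choose_eq_zero_of_lt]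
    simp [this]

theorem mode_mem {p q k : ℕ} {a b : V} (ha : a ∈ wtSpace p) (hb : b ∈ wtSpace q) {n : ℤ}
    (hk : (k : ℤ) = p + q - n - 1) : mode n a b ∈ wtSpace k :=
  (mem_wtSpace_of_eigen (L_zero_mode ha hb n)).1 k hk

theorem mode_neg_one_mem {p q : ℕ} {a b : V} (ha : a ∈ wtSpace p) (hb : b ∈ wtSpace q) :
    mode (-1) a b ∈ wtSpace (p + q) := mode_mem ha hb (by push_cast; ring)

theorem mode_eq_zero {p q : ℕ} {a b : V} (ha : a ∈ wtSpace p) (hb : b ∈ wtSpace q) {n : ℤ}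
    (hn : (p : ℤ) + q - n - 1 < 0) : mode n a b = 0 :=
  (mem_wtSpace_of_eigen (L_zero_mode ha hb n)).2 hn

theorem wtSpace_induction {P : V → Prop} (a : V) (hom : ∀ n, ∀ a ∈ wtSpace n, P a)
    (zero : P 0) (add : ∀ a b, P a → P b → P (a + b)) : P a := by
  obtain ⟨x, rfl⟩ := (isInternal_wtSpace (V := V)).2 a
  induction x using DirectSum.induction_on with
  | zero => rw [map_zero]; exact zero
  | of i x =>
    rw [DirectSum.coeAddMonoidHom_of]; exact hom i x x.2
  | add x y hx hy => rw [map_add]; exact add _ _ hx hy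

/-! ### Residues

`res m f a b` is the residue of `Y(a, z) b f(z) z ^ (-m)` for a polynomial `f`. -/

open Polynomial in
noncomputable def res (m : ℤ) : ℂ[X] →ₗ[ℂ] V →ₗ[ℂ] V →ₗ[ℂ] V :=
  Polynomial.lsum fun i => LinearMap.toSpanSingleton ℂ (V →ₗ[ℂ] V →ₗ[ℂ] V) (mode (i - m))

open Polynomial in
theorem res_monomial (m : ℤ) (i : ℕ) (r : ℂ) (a b : V) :
    res m (monomial i r) a b = r • mode (i - m) a b := by
  simp [res, Polynomial.lsum_apply]

open Polynomial in
theorem res_X_mul (m : ℤ) (f : ℂ[X]) (a b : V) : res m (X * f) a b = res (m - 1) f a b := by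
  induction f using Polynomial.induction_on' with
  | add f g hf hg => simp only [mul_add, map_add, LinearMap.add_apply, hf, hg]
  | monomial i r =>
    rw [X_mul_monomial, res_monomial, res_monomial,
      show ((i + 1 : ℕ) : ℤ) - m = i - (m - 1) by push_cast; ring]

open Polynomial in
theorem res_one_add_X_mul (m : ℤ) (f : ℂ[X]) (a b : V) :
    res m ((1 + X) * f) a b = res m f a b + res (m - 1) f a b := by
  rw [add_mul, one_mul, map_add, LinearMap.add_apply, LinearMap.add_apply, res_X_mul]

open Polynomial in
theorem res_conf (m : ℤ) (f : ℂ[X]) (a b : V) :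
    res m f (mode 0 conf a) b =
      (m : ℂ) • res (m + 1) f a b - res m (derivative f) a b := by
  induction f using Polynomial.induction_on' with
  | add f g hf hg =>
    simp only [map_add, LinearMap.add_apply, hf, hg]; module
  | monomial i r =>
    rw [derivative_monomial, res_monomial, res_monomial, res_monomial, mode_zero_conf,
      ← Int.cast_smul_eq_zsmul ℂ]
    rcases i with _ | i
    · simp only [Nat.cast_zero, mul_zero, zero_smul, sub_zero, smul_smul]
      rw [show (0 : ℤ) - m - 1 = 0 - (m + 1) by ring]
      push_cast; congr 1; ring
    · rw [show ((i + 1 : ℕ) : ℤ) - m - 1 = i - m by push_cast; ring,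
        show ((i + 1 : ℕ) : ℤ) - (m + 1) = i - m by push_cast; ring, Nat.add_sub_cancel]
      push_cast; module

open Polynomial in
theorem res_natCast_pow (m : ℤ) (p : ℕ) (a b : V) :
    res m ((1 + X) ^ p) a b =
      ∑ j ∈ Finset.range (p + 1), (p.choose j : ℂ) • mode (j - m) a b := by
  have : ((1 + X) ^ p : ℂ[X]) = ∑ j ∈ Finset.range (p + 1), monomial j (p.choose j : ℂ) := by
    rw [add_comm, add_pow]
    refine Finset.sum_congr rfl fun j _ => ?_
    rw [one_pow, mul_one, ← C_mul_X_pow_eq_monomial, mul_comm]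
    simp
  rw [this, map_sum, LinearMap.sum_apply, LinearMap.sum_apply]
  exact Finset.sum_congr rfl fun j _ => res_monomial _ _ _ _ _

open Polynomial in
theorem hasseDeriv_one_add_X_pow (k p : ℕ) :
    hasseDeriv k ((1 + X) ^ p : ℂ[X]) = (p.choose k : ℂ) • (1 + X) ^ (p - k) := by
  have h := congrArg (fun F => F ((1 + X) ^ p : ℂ[X])) (factorial_smul_hasseDeriv (R := ℂ) (k := k))
  simp only [LinearMap.smul_apply] at h
  have h' : (⇑derivative)^[k] ((1 + X) ^ p : ℂ[X]) = (p.descFactorial k : ℂ) • (1 + X) ^ (p - k) := by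
    rw [add_comm, ← C_1, iterate_derivative_X_add_pow, nsmul_eq_mul, smul_eq_C_mul]
    simp
  have hk : ((k.factorial : ℕ) : ℂ) ≠ 0 := by exact_mod_cast k.factorial_ne_zero
  have h2 : (k.factorial : ℂ) • hasseDeriv k ((1 + X) ^ p : ℂ[X]) =
      (k.factorial : ℂ) • ((p.choose k : ℂ) • (1 + X) ^ (p - k) : ℂ[X]) := by
    rw [smul_smul, ← Nat.cast_mul, ← Nat.descFactorial_eq_factorial_mul_choose, ← h',
      Nat.cast_smul_eq_nsmul]
    exact h
  exact smul_right_injective _ hk h2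

open Polynomial in
/-- The Jacobi identity, paired with `f(z) g(w) (z - w) ^ l z ^ m w ^ n`. -/
theorem borcherds_res (a b c : V) (l m n : ℤ) (N : ℕ)
    (h1 : ∀ j : ℕ, N ≤ j → mode (l + j) a b = 0)
    (h2 : ∀ j : ℕ, N ≤ j → mode (n + j) b c = 0)
    (h3 : ∀ j : ℕ, N ≤ j → mode (m + j) a c = 0) (f g : ℂ[X]) :
    ∑ k ∈ Finset.range N, ∑ rs ∈ Finset.HasAntidiagonal.antidiagonal k,
        ((Ring.choose m rs.2 : ℤ) : ℂ) •
          res (rs.2 - m - n) (hasseDeriv rs.1 f * g) (mode (l + k) a b) c =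
      ∑ k ∈ Finset.range N, (((-1) ^ k * Ring.choose l k : ℤ) : ℂ) •
        (res (k - l - m) f a (res (-n - k) g b c) -
          l.negOnePow • res (k - n - l) g b (res (-m - k) f a c)) := by
  induction f using Polynomial.induction_on' with
  | add f f' hf hf' =>
    simp only [map_add, LinearMap.add_apply, add_mul, smul_add, Finset.sum_add_distrib, smul_sub,
      Finset.sum_sub_distrib] at hf hf' ⊢
    rw [hf, hf']; abel
  | monomial i r =>
  induction g using Polynomial.induction_on' with
  | add f f' hf hf' =>
    simp only [map_add, LinearMap.add_apply, mul_add, smul_add, Finset.sum_add_distrib, smul_sub,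
      Finset.sum_sub_distrib] at hf hf' ⊢
    rw [hf, hf']; abel
  | monomial s t =>
  have h := congrArg (fun v => (r * t) • v) <| borcherds_range a b c l (m + i) (n + s) N h1
    (fun j hj => by have := h2 (j + s) (by omega); rw [← this]; congr 2; push_cast; ring_nf)
    (fun j hj => by have := h3 (j + i) (by omega); rw [← this]; congr 2; push_cast; ring_nf)
  simp only [Finset.smul_sum] at h
  convert h using 1
  · refine Finset.sum_congr rfl fun k _ => ?_
    rw [add_comm m, Ring.add_choose_eq k (Commute.all _ _), Finset.sum_smul, Finset.smul_sum]
    refine Finset.sum_congr rfl fun rs hrs => ?_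
    rw [Finset.HasAntidiagonal.mem_antidiagonal] at hrs
    rw [hasseDeriv_monomial, monomial_mul_monomial, res_monomial, Ring.choose_natCast]
    by_cases hi : rs.1 ≤ i
    · rw [← Int.cast_smul_eq_zsmul ℂ, smul_smul, smul_smul]
      congr 1
      · push_cast; ring
      · congr 2; push_cast [Nat.cast_sub hi, ← hrs]; ring_nf
    · rw [Nat.choose_eq_zero_of_lt (by omega)]; simp
  · refine Finset.sum_congr rfl fun k _ => ?_
    simp only [res_monomial, map_smul]
    rw [← Int.cast_smul_eq_zsmul ℂ]
    simp only [Units.smul_def, ← Int.cast_smul_eq_zsmul ℂ]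
    rw [show (i : ℤ) - (k - l - m) = m + i + l - k by ring,
      show (s : ℤ) - (-n - k) = n + s + k by ring,
      show (s : ℤ) - (k - n - l) = n + s + l - k by ring,
      show (i : ℤ) - (-m - k) = m + i + k by ring]
    module

/-! ### Quotients by two-sided ideals -/

/-- The bilinear product on `M ⧸ N` induced by a bilinear product `μ` on `M` for which the
subspace `N` is a two-sided ideal. -/
noncomputable def quotMul {M : Type*} [AddCommGroup M] [Module ℂ M] (N : Submodule ℂ M)
    (μ : M →ₗ[ℂ] M →ₗ[ℂ] M) (hl : ∀ a, ∀ x ∈ N, μ a x ∈ N) (hr : ∀ x ∈ N, ∀ b, μ x b ∈ N) :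
    M ⧸ N →ₗ[ℂ] M ⧸ N →ₗ[ℂ] M ⧸ N :=
  N.liftQ
    { toFun := fun a => N.mapQ N (μ a) (hl a)
      map_add' := fun a b => by ext; simp
      map_smul' := fun r a => by ext; simp }
    (fun x hx => by
      rw [LinearMap.mem_ker]
      ext b
      exact (Submodule.Quotient.mk_eq_zero N).2 (hr x hx b))

/-! ### The `C₂`-algebra -/

section C2

variable (V) in
/-- `C₂(V)`, the span of all `a_{-2} b`. -/
def C2 : Submodule ℂ V := Submodule.span ℂ {x | ∃ a b : V, x = mode (-2) a b}

theorem mode_mem_C2 (n : ℕ) (a b : V) : mode (-2 - n) a b ∈ C2 V := by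
  induction n generalizing a with
  | zero => exact Submodule.subset_span ⟨a, b, by simp⟩
  | succ n ih =>
    have h := ih (mode 0 conf a)
    rw [mode_zero_conf, ← Int.cast_smul_eq_zsmul ℂ] at h
    have hn : ((-(-2 - (n : ℤ)) : ℤ) : ℂ) ≠ 0 := by
      rw [Int.cast_ne_zero]; omega
    rw [Submodule.smul_mem_iff _ hn] at h
    rwa [show -2 - (n : ℤ) - 1 = -2 - ((n + 1 : ℕ) : ℤ) by push_cast; ring] at h

theorem mode_mem_C2' {n : ℤ} (hn : n ≤ -2) (a b : V) : mode n a b ∈ C2 V := by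
  have := mode_mem_C2 (-2 - n).toNat a b
  rwa [show -2 - ((-2 - n).toNat : ℤ) = n by omega] at this

/-- `[a_{-1}, b_{-n}] c ∈ C₂(V)` for `n ≥ 1`. -/
theorem commutator_mem_C2 (a b c : V) {n : ℤ} (hn : n ≤ -1) :
    mode (-1) a (mode n b c) - mode n b (mode (-1) a c) ∈ C2 V := by
  obtain ⟨N, h1, h2, h3⟩ := exists_bound a b c 0 (-1) n
  have h := borcherds_range a b c 0 (-1) n (N + 1) (fun j hj => h1 j (by omega))
    (fun j hj => h2 j (by omega)) (fun j hj => h3 j (by omega))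
  rw [eq_comm, Finset.sum_range_succ' _ N, Finset.sum_eq_zero] at h
  · simp only [Ring.choose_zero_right, zero_add, Nat.cast_zero, pow_zero, Int.negOnePow_zero,
      add_zero, sub_zero, one_smul, mul_one] at h
    rw [h]
    refine Submodule.sum_mem _ fun j _ => ?_
    rw [← Int.cast_smul_eq_zsmul ℂ]
    exact Submodule.smul_mem _ _ (mode_mem_C2' (by omega) _ _)
  · intro j _
    have : Ring.choose (0 : ℤ) (j + 1) = 0 := Ring.choose_zero_pos ℤ (by omega)
    simp [this]

theorem mul_mem_C2_right (a : V) : ∀ x ∈ C2 V, mode (-1) a x ∈ C2 V := by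
  intro x hx
  refine Submodule.span_induction (p := fun x _ => mode (-1) a x ∈ C2 V) ?_ ?_ ?_ ?_ hx
  · rintro _ ⟨b, c, rfl⟩
    have h := commutator_mem_C2 a b c (n := -2) (by norm_num)
    have := Submodule.add_mem _ h (mode_mem_C2' le_rfl b (mode (-1) a c))
    rwa [sub_add_cancel] at this
  · simp
  · intro x y _ _ hx hy; rw [map_add]; exact Submodule.add_mem _ hx hy
  · intro r x _ hx; rw [map_smul]; exact Submodule.smul_mem _ _ hx

/-- `(a_l b)_{-1} c` is `a_{-1} (b_{-1} c)` for `l = -1` and zero for `l = -2`, modulo `C₂(V)`. -/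
theorem iterate_mem_C2 (a b c : V) :
    mode (-1) (mode (-2) a b) c ∈ C2 V ∧
      mode (-1) (mode (-1) a b) c - mode (-1) a (mode (-1) b c) ∈ C2 V := by
  have key : ∀ l : ℤ, ∃ N : ℕ, mode (-1) (mode l a b) c =
      ∑ j ∈ Finset.range N, ((-1) ^ (j + 1) * Ring.choose l (j + 1)) •
        (mode (l - (j + 1)) a (mode (-1 + (j + 1)) b c) -
          l.negOnePow • mode (-1 + l - (j + 1)) b (mode (j + 1) a c)) +
      (mode l a (mode (-1) b c) - l.negOnePow • mode (-1 + l) b (mode 0 a c)) := by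
    intro l
    obtain ⟨N, h1, h2, h3⟩ := exists_bound a b c l 0 (-1)
    have h := borcherds_range a b c l 0 (-1) (N + 1) (fun j hj => h1 j (by omega))
      (fun j hj => h2 j (by omega)) (fun j hj => h3 j (by omega))
    rw [Finset.sum_range_succ' _ N, Finset.sum_eq_zero, Finset.sum_range_succ' _ N] at h
    · refine ⟨N, ?_⟩
      simpa using h
    · intro j _
      have : Ring.choose (0 : ℤ) (j + 1) = 0 := Ring.choose_zero_pos ℤ (by omega)
      simp [this]
  constructor
  · obtain ⟨N, h⟩ := key (-2)
    rw [h]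
    simp only [Units.smul_def, ← Int.cast_smul_eq_zsmul ℂ]
    refine Submodule.add_mem _ (Submodule.sum_mem _ fun j _ => Submodule.smul_mem _ _ ?_) ?_
    all_goals
      exact Submodule.sub_mem _ (mode_mem_C2' (by omega) _ _)
        (Submodule.smul_mem _ _ (mode_mem_C2' (by omega) _ _))
  · obtain ⟨N, h⟩ := key (-1)
    rw [h]
    simp only [Units.smul_def, ← Int.cast_smul_eq_zsmul ℂ]
    rw [add_sub_assoc, sub_sub_cancel_left]
    refine Submodule.add_mem _ (Submodule.sum_mem _ fun j _ => Submodule.smul_mem _ _ ?_)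
      (Submodule.neg_mem _ (Submodule.smul_mem _ _ (mode_mem_C2' (by omega) _ _)))
    exact Submodule.sub_mem _ (mode_mem_C2' (by omega) _ _)
        (Submodule.smul_mem _ _ (mode_mem_C2' (by omega) _ _))

theorem mul_mem_C2_left : ∀ x ∈ C2 V, ∀ c : V, mode (-1) x c ∈ C2 V := by
  intro x hx c
  refine Submodule.span_induction (p := fun x _ => mode (-1) x c ∈ C2 V) ?_ ?_ ?_ ?_ hx
  · rintro _ ⟨a, b, rfl⟩
    exact (iterate_mem_C2 a b c).1
  · simp
  · intro x y _ _ hx hy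
    rw [map_add, LinearMap.add_apply]; exact Submodule.add_mem _ hx hy
  · intro r x _ hx
    rw [map_smul, LinearMap.smul_apply]; exact Submodule.smul_mem _ _ hx

variable (V) in
/-- Zhu's `C₂`-algebra `V / C₂(V)`. -/
def C2Algebra : Type _ := V ⧸ C2 V

noncomputable instance : AddCommGroup (C2Algebra V) := inferInstanceAs (AddCommGroup (V ⧸ C2 V))

noncomputable instance : Module ℂ (C2Algebra V) := inferInstanceAs (Module ℂ (V ⧸ C2 V))

namespace C2Algebra

/-- The class `a + C₂(V)`. -/
def mk : V →ₗ[ℂ] C2Algebra V := (C2 V).mkQ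

theorem mk_surjective : Function.Surjective (mk : V →ₗ[ℂ] C2Algebra V) := (C2 V).mkQ_surjective

theorem mk_eq_mk {a b : V} : (mk a : C2Algebra V) = mk b ↔ a - b ∈ C2 V := Submodule.Quotient.eq _

variable (V) in
/-- The product of `V / C₂(V)`, induced by `a_{-1} b`. -/
noncomputable def mulLin : C2Algebra V →ₗ[ℂ] C2Algebra V →ₗ[ℂ] C2Algebra V :=
  quotMul (C2 V) (mode (-1)) mul_mem_C2_right mul_mem_C2_left

noncomputable instance : Mul (C2Algebra V) := ⟨fun x y => mulLin V x y⟩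

noncomputable instance : One (C2Algebra V) := ⟨mk vac⟩

theorem mul_def (x y : C2Algebra V) : x * y = mulLin V x y := rfl

theorem mk_mul_mk (a b : V) : (mk a * mk b : C2Algebra V) = mk (mode (-1) a b) := rfl

noncomputable instance : CommRing (C2Algebra V) where
  __ := (inferInstance : AddCommGroup (C2Algebra V))
  left_distrib x y z := by simp only [mul_def, map_add]
  right_distrib x y z := by simp only [mul_def, map_add, LinearMap.add_apply]
  zero_mul x := by simp only [mul_def, map_zero, LinearMap.zero_apply]
  mul_zero x := by simp only [mul_def, map_zero]
  mul_assoc x y z := by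
    obtain ⟨a, rfl⟩ := mk_surjective x
    obtain ⟨b, rfl⟩ := mk_surjective y
    obtain ⟨c, rfl⟩ := mk_surjective z
    simp only [mk_mul_mk, mk_eq_mk]
    exact (iterate_mem_C2 a b c).2
  one_mul x := by
    obtain ⟨a, rfl⟩ := mk_surjective x
    change mk (mode (-1) vac a) = mk a
    rw [mode_vac_left, if_pos rfl]
  mul_one x := by
    obtain ⟨a, rfl⟩ := mk_surjective x
    change mk (mode (-1) a vac) = mk a
    rw [mode_vac_right]
  mul_comm x y := by
    obtain ⟨a, rfl⟩ := mk_surjective x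
    obtain ⟨b, rfl⟩ := mk_surjective y
    simp only [mk_mul_mk, mk_eq_mk]
    have h := commutator_mem_C2 a b vac (n := -1) le_rfl
    rwa [mode_vac_right, mode_vac_right] at h

noncomputable instance : Algebra ℂ (C2Algebra V) :=
  Algebra.ofModule (fun r x y => by simp only [mul_def, map_smul, LinearMap.smul_apply])
    (fun r x y => by simp only [mul_def, map_smul])

end C2Algebra

end C2

/-! ### Zhu's algebra -/

section Zhu

/-- `a ∗ b = ∑_j (n choose j) a_{j-1} b`, for `a` of weight `n`. -/
noncomputable def zhuStar (n : ℕ) : V →ₗ[ℂ] V →ₗ[ℂ] V :=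
  ∑ j ∈ Finset.range (n + 1), (n.choose j : ℂ) • mode (j - 1)

/-- `a ∘ b = Res_z Y(a, z) b (1 + z) ^ n / z ^ 2 = ∑_j (n choose j) a_{j-2} b`, for `a` of
weight `n`. -/
noncomputable def zhuCirc (n : ℕ) : V →ₗ[ℂ] V →ₗ[ℂ] V :=
  ∑ j ∈ Finset.range (n + 1), (n.choose j : ℂ) • mode (j - 2)

variable (V) in
/-- `a ∗ b` for all `a`, `b` in `V`, by linearity in `a`. -/
noncomputable def zhuMul : V →ₗ[ℂ] V →ₗ[ℂ] V :=
  DirectSum.toModule ℂ ℕ (V →ₗ[ℂ] V) (fun n => (zhuStar n).domRestrict (wtSpace n)) ∘ₗ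
    (LinearEquiv.ofBijective (DirectSum.coeLinearMap (wtSpace (V := V)))
      isInternal_wtSpace).symm.toLinearMap

variable (V) in
/-- `O(V)`, the span of all `a ∘ b` with `a` homogeneous. -/
def zhuO : Submodule ℂ V :=
  Submodule.span ℂ {x | ∃ n : ℕ, ∃ a ∈ wtSpace (V := V) n, ∃ b : V, x = zhuCirc n a b}

theorem zhuMul_apply {n : ℕ} {a : V} (ha : a ∈ wtSpace n) (b : V) :
    zhuMul V a b = zhuStar n a b := by
  have : (LinearEquiv.ofBijective (DirectSum.coeLinearMap (wtSpace (V := V)))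
      isInternal_wtSpace).symm a = DirectSum.lof ℂ ℕ (fun n => wtSpace (V := V) n) n ⟨a, ha⟩ := by
    rw [LinearEquiv.symm_apply_eq]
    exact (DirectSum.coeLinearMap_lof (wtSpace (V := V)) n ⟨a, ha⟩).symm
  rw [zhuMul, LinearMap.comp_apply, LinearEquiv.coe_coe, this, DirectSum.toModule_lof]
  rfl

open Polynomial in
theorem zhuStar_eq (n : ℕ) (a b : V) : zhuStar n a b = res 1 ((1 + X) ^ n) a b := by
  simp [zhuStar, res_natCast_pow]

open Polynomial in
theorem zhuCirc_eq (n : ℕ) (a b : V) : zhuCirc n a b = res 2 ((1 + X) ^ n) a b := by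
  simp [zhuCirc, res_natCast_pow]

theorem conf_zero_mem {p : ℕ} {a : V} (ha : a ∈ wtSpace p) : mode 0 conf a ∈ wtSpace (p + 1) :=
  mode_mem conf_mem ha (by push_cast; ring)

open Polynomial in
theorem res_mem_zhuO (k p : ℕ) (a b : V) (ha : a ∈ wtSpace p) :
    res (2 + k) ((1 + X) ^ p) a b ∈ zhuO V := by
  induction k generalizing p a with
  | zero =>
    refine Submodule.subset_span ⟨p, a, ha, b, ?_⟩
    rw [zhuCirc_eq]; simp
  | succ k ih =>
    have h := ih (p + 1) _ (conf_zero_mem ha)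
    rw [res_conf] at h
    have hd : derivative ((1 + X) ^ (p + 1) : ℂ[X]) = ((p : ℂ) + 1) • (1 + X) ^ p := by
      rw [derivative_pow_succ, smul_eq_C_mul]; simp
    rw [hd, pow_succ', res_one_add_X_mul, map_smul, LinearMap.smul_apply, LinearMap.smul_apply,
      add_sub_cancel_right] at h
    have h' := Submodule.sub_mem _ h
      (Submodule.smul_mem _ (((2 + k : ℤ) : ℂ) - (p + 1)) (ih p a ha))
    have e : ((2 + k : ℤ) : ℂ) • res (2 + k + 1) ((1 + X) ^ p) a b ∈ zhuO V := by
      convert h' using 1; module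
    rw [Submodule.smul_mem_iff _ (by rw [Int.cast_ne_zero]; omega)] at e
    rwa [Nat.cast_succ, ← add_assoc]

open Polynomial in
theorem res_mem_zhuO' (n p : ℕ) (a b : V) (ha : a ∈ wtSpace p) (m : ℤ) (hm : 2 + n ≤ m) :
    res m ((1 + X) ^ (p + n)) a b ∈ zhuO V := by
  induction n generalizing m with
  | zero =>
    have := res_mem_zhuO (m - 2).toNat p a b ha
    rwa [show 2 + ((m - 2).toNat : ℤ) = m by omega] at this
  | succ n ih =>
    rw [← add_assoc, pow_succ', res_one_add_X_mul]
    exact Submodule.add_mem _ (ih m (by omega)) (ih (m - 1) (by omega))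

open Polynomial in
/-- `∑_k (p choose k) Res_w Y(a_{k-1-e} b, w) c (1 + w) ^ (p + q + e - k) / w`, modulo `O(V)`. -/
theorem iterate_mem_zhuO {p q : ℕ} {a b : V} (ha : a ∈ wtSpace p) (hb : b ∈ wtSpace q) (c : V)
    (e : ℕ) :
    ∑ k ∈ Finset.range (p + 1), (p.choose k : ℂ) •
        res 1 ((1 + X) ^ (p + q + e - k)) (mode (k - (1 + e)) a b) c -
      res (1 + e) ((1 + X) ^ p) a (res 1 ((1 + X) ^ (q + e)) b c) ∈ zhuO V := by
  obtain ⟨N, h1, h2, h3⟩ := exists_bound a b c (-(1 + e)) 0 (-1)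
  have h := borcherds_res a b c (-(1 + e)) 0 (-1) (N + p + 1) (fun j hj => h1 j (by omega))
    (fun j hj => h2 j (by omega)) (fun j hj => h3 j (by omega)) ((1 + X) ^ p)
    ((1 + X) ^ (q + e))
  have hs : ∑ k ∈ Finset.range (p + 1), (p.choose k : ℂ) •
        res 1 ((1 + X) ^ (p + q + e - k)) (mode (k - (1 + e)) a b) c =
      ∑ k ∈ Finset.range (N + p + 1), ∑ rs ∈ Finset.HasAntidiagonal.antidiagonal k,
        ((Ring.choose (0 : ℤ) rs.2 : ℤ) : ℂ) •
          res (rs.2 - 0 - (-1)) (hasseDeriv rs.1 ((1 + X) ^ p) * (1 + X) ^ (q + e))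
            (mode (-(1 + e) + k) a b) c := by
    have hsub : Finset.range (p + 1) ⊆ Finset.range (N + p + 1) :=
      Finset.range_mono (by omega)
    have hk : ∀ k : ℕ, ∑ rs ∈ Finset.HasAntidiagonal.antidiagonal k,
        ((Ring.choose (0 : ℤ) rs.2 : ℤ) : ℂ) •
          res (rs.2 - 0 - (-1)) (hasseDeriv rs.1 ((1 + X) ^ p) * (1 + X) ^ (q + e))
            (mode (-(1 + e) + k) a b) c =
        (p.choose k : ℂ) • res 1 ((1 + X) ^ (p - k + (q + e))) (mode (-(1 + e) + k) a b) c := by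
      intro k
      rw [Finset.sum_eq_single (k, 0)]
      · rw [hasseDeriv_one_add_X_pow, smul_mul_assoc, ← pow_add]
        simp
      · rintro ⟨r, s⟩ hrs hne
        rw [Finset.HasAntidiagonal.mem_antidiagonal] at hrs
        have hs : 0 < s := by
          rcases s with _ | s
          · exact absurd (by simpa using hrs) (fun h : r = k => hne (by rw [h]))
          · omega
        have : Ring.choose (0 : ℤ) s = 0 := Ring.choose_zero_pos ℤ hs
        simp [this]
      · intro hn
        exact absurd (Finset.HasAntidiagonal.mem_antidiagonal.2 (by simp)) hn
    simp only [hk]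
    rw [← Finset.sum_subset hsub]
    · refine Finset.sum_congr rfl fun k hk => ?_
      rw [Finset.mem_range] at hk
      rw [neg_add_eq_sub, show p - k + (q + e) = p + q + e - k by omega]
    · intro k _ hk
      rw [Finset.mem_range, not_lt] at hk
      rw [Nat.choose_eq_zero_of_lt (by omega)]; simp
  rw [hs, h, Finset.sum_range_succ']
  simp only [Units.smul_def, ← Int.cast_smul_eq_zsmul ℂ]
  have e0 : (((-1) ^ 0 * Ring.choose (-(1 + e) : ℤ) 0 : ℤ) : ℂ) = 1 := by simp
  rw [e0, one_smul]
  rw [show ((0 : ℕ) : ℤ) - -(1 + e) - 0 = 1 + e by simp, show -(-1 : ℤ) - (0 : ℕ) = 1 by simp,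
    add_sub_assoc, sub_sub_cancel_left]
  have haO : ∀ (m : ℤ) (x : V), 2 ≤ m → res m ((1 + X) ^ p) a x ∈ zhuO V := fun m x hm => by
    simpa using res_mem_zhuO' 0 p a x ha m (by simpa using hm)
  have hbO : ∀ (m : ℤ) (x : V), 2 + e ≤ m → res m ((1 + X) ^ (q + e)) b x ∈ zhuO V :=
    fun m x hm => res_mem_zhuO' e q b x hb m hm
  refine Submodule.add_mem _ (Submodule.sum_mem _ fun k _ => Submodule.smul_mem _ _ ?_)
    (Submodule.neg_mem _ (Submodule.smul_mem _ _ (hbO _ _ (by push_cast; omega))))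
  exact Submodule.sub_mem _ (haO _ _ (by push_cast; omega))
    (Submodule.smul_mem _ _ (hbO _ _ (by push_cast; omega)))

open Polynomial in
/-- `a ∗ (b ∘ c) - b ∘ (a ∗ c)` is in `O(V)`. -/
theorem commutator_mem_zhuO {p q : ℕ} {a b : V} (ha : a ∈ wtSpace p) (hb : b ∈ wtSpace q) (c : V) :
    res 1 ((1 + X) ^ p) a (res 2 ((1 + X) ^ q) b c) -
      res 2 ((1 + X) ^ q) b (res 1 ((1 + X) ^ p) a c) ∈ zhuO V := by
  obtain ⟨N, h1, h2, h3⟩ := exists_bound a b c 0 (-1) (-2)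
  have h := borcherds_res a b c 0 (-1) (-2) (N + 1) (fun j hj => h1 j (by omega))
    (fun j hj => h2 j (by omega)) (fun j hj => h3 j (by omega)) ((1 + X) ^ p) ((1 + X) ^ q)
  rw [eq_comm, Finset.sum_range_succ' _ N, Finset.sum_eq_zero] at h
  · simp only [Ring.choose_zero_right, zero_add, Nat.cast_zero, pow_zero, Int.negOnePow_zero,
      sub_zero, one_smul, mul_one, Int.cast_one, neg_neg, zero_sub] at h
    rw [h]
    refine Submodule.sum_mem _ fun k _ => Submodule.sum_mem _ fun rs hrs =>
      Submodule.smul_mem _ _ ?_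
    rw [Finset.HasAntidiagonal.mem_antidiagonal] at hrs
    rw [hasseDeriv_one_add_X_pow, smul_mul_assoc, ← pow_add, map_smul, LinearMap.smul_apply,
      LinearMap.smul_apply]
    by_cases hk : k + 1 ≤ p + q
    · by_cases hp : rs.1 ≤ p
      · refine Submodule.smul_mem _ _ ?_
        rw [show p - rs.1 + q = (p + q - k - 1) + (rs.2 + 1) by omega]
        refine res_mem_zhuO' _ _ _ _ (mode_mem ha hb ?_) _ ?_
        · omega
        · push_cast; omega
      · rw [Nat.choose_eq_zero_of_lt (by omega)]; simp
    · rw [mode_eq_zero ha hb (by omega)]; simp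
  · intro j _
    have : Ring.choose (0 : ℤ) (j + 1) = 0 := Ring.choose_zero_pos ℤ (by omega)
    simp [this]

theorem zhuMul_mem_right (a : V) : ∀ x ∈ zhuO V, zhuMul V a x ∈ zhuO V := by
  intro x hx
  refine Submodule.span_induction (p := fun x _ => zhuMul V a x ∈ zhuO V) ?_ ?_ ?_ ?_ hx
  · rintro _ ⟨q, b, hb, c, rfl⟩
    refine wtSpace_induction (P := fun a => zhuMul V a (zhuCirc q b c) ∈ zhuO V) a ?_ ?_ ?_
    · intro p a ha
      rw [zhuMul_apply ha, zhuStar_eq, zhuCirc_eq]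
      have h := Submodule.add_mem _ (commutator_mem_zhuO ha hb c)
        (res_mem_zhuO 0 q b (res 1 ((1 + Polynomial.X) ^ p) a c) hb)
      rwa [Nat.cast_zero, add_zero, sub_add_cancel] at h
    · simp
    · intro x y hx hy
      rw [map_add, LinearMap.add_apply]; exact Submodule.add_mem _ hx hy
  · simp
  · intro x y _ _ hx hy; rw [map_add]; exact Submodule.add_mem _ hx hy
  · intro r x _ hx; rw [map_smul]; exact Submodule.smul_mem _ _ hx

open Polynomial in
theorem zhuMul_sum {p q : ℕ} {a b : V} (ha : a ∈ wtSpace p) (hb : b ∈ wtSpace q) (c : V) (e : ℕ) :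
    zhuMul V (∑ j ∈ Finset.range (p + 1), (p.choose j : ℂ) • mode (j - (1 + e)) a b) c =
      ∑ k ∈ Finset.range (p + 1), (p.choose k : ℂ) •
        res 1 ((1 + X) ^ (p + q + e - k)) (mode (k - (1 + e)) a b) c := by
  rw [map_sum, LinearMap.sum_apply]
  refine Finset.sum_congr rfl fun k hk => ?_
  rw [Finset.mem_range] at hk
  have hm : mode (k - (1 + e)) a b ∈ wtSpace (p + q + e - k) := mode_mem ha hb (by omega)
  rw [map_smul, LinearMap.smul_apply, zhuMul_apply hm, zhuStar_eq]

theorem zhuMul_mem_left : ∀ x ∈ zhuO V, ∀ c, zhuMul V x c ∈ zhuO V := by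
  intro x hx c
  refine Submodule.span_induction (p := fun x _ => zhuMul V x c ∈ zhuO V) ?_ ?_ ?_ ?_ hx
  · rintro _ ⟨p, a, ha, b, rfl⟩
    refine wtSpace_induction (P := fun b => zhuMul V (zhuCirc p a b) c ∈ zhuO V) b ?_ ?_ ?_
    · intro q b hb
      have h := iterate_mem_zhuO ha hb c 1
      rw [← zhuMul_sum ha hb c 1] at h
      have h' := Submodule.add_mem _ h (res_mem_zhuO 0 p a
        (res 1 ((1 + Polynomial.X) ^ (q + 1)) b c) ha)
      rw [Nat.cast_zero, add_zero, Nat.cast_one, one_add_one_eq_two, sub_add_cancel] at h'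
      simpa [zhuCirc] using h'
    · simp
    · intro x y hx hy
      rw [map_add, map_add, LinearMap.add_apply]; exact Submodule.add_mem _ hx hy
  · simp
  · intro x y _ _ hx hy
    rw [map_add, LinearMap.add_apply]; exact Submodule.add_mem _ hx hy
  · intro r x _ hx
    rw [map_smul, LinearMap.smul_apply]; exact Submodule.smul_mem _ _ hx

theorem zhuMul_assoc_mem (a b c : V) :
    zhuMul V (zhuMul V a b) c - zhuMul V a (zhuMul V b c) ∈ zhuO V := by
  refine wtSpace_induction (P := fun a => zhuMul V (zhuMul V a b) c -
    zhuMul V a (zhuMul V b c) ∈ zhuO V) a ?_ (by simp) ?_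
  · intro p a ha
    refine wtSpace_induction (P := fun b => zhuMul V (zhuMul V a b) c -
      zhuMul V a (zhuMul V b c) ∈ zhuO V) b ?_ (by simp) ?_
    · intro q b hb
      have h := iterate_mem_zhuO ha hb c 0
      rw [← zhuMul_sum ha hb c 0] at h
      rw [zhuMul_apply ha, zhuMul_apply ha, zhuMul_apply hb, zhuStar_eq p a (zhuStar q b c),
        zhuStar_eq q b c]
      simpa [zhuStar] using h
    · intro x y hx hy
      have := Submodule.add_mem _ hx hy
      simp only [map_add, LinearMap.add_apply]
      convert this using 1; abel
  · intro x y hx hy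
    have := Submodule.add_mem _ hx hy
    simp only [map_add, LinearMap.add_apply]
    convert this using 1; abel

theorem vac_zhuMul (a : V) : zhuMul V vac a = a := by
  rw [zhuMul_apply vac_mem]
  simp [zhuStar, mode_vac_left]

theorem zhuMul_vac (a : V) : zhuMul V a vac = a := by
  refine wtSpace_induction (P := fun a => zhuMul V a vac = a) a ?_ (by simp) ?_
  · intro n a ha
    rw [zhuMul_apply ha, zhuStar, LinearMap.sum_apply, LinearMap.sum_apply,
      Finset.sum_range_succ', Finset.sum_eq_zero]
    · simp [mode_vac_right]
    · intro j _
      rw [LinearMap.smul_apply, LinearMap.smul_apply, mode_vac_right_nonneg a (by simp), smul_zero]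
  · intro x y hx hy
    rw [map_add, LinearMap.add_apply, hx, hy]

variable (V) in
/-- Zhu's algebra `A(V) = V / O(V)`. -/
def ZhuAlgebra : Type _ := V ⧸ zhuO V

noncomputable instance : AddCommGroup (ZhuAlgebra V) := inferInstanceAs (AddCommGroup (V ⧸ zhuO V))

noncomputable instance : Module ℂ (ZhuAlgebra V) := inferInstanceAs (Module ℂ (V ⧸ zhuO V))

namespace ZhuAlgebra

/-- The class `a + O(V)`. -/
def mk : V →ₗ[ℂ] ZhuAlgebra V := (zhuO V).mkQ

theorem mk_surjective : Function.Surjective (mk : V →ₗ[ℂ] ZhuAlgebra V) :=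
  (zhuO V).mkQ_surjective

theorem mk_eq_mk {a b : V} : (mk a : ZhuAlgebra V) = mk b ↔ a - b ∈ zhuO V :=
  Submodule.Quotient.eq _

variable (V) in
/-- The product of `A(V)`, induced by `a ∗ b`. -/
noncomputable def mulLin : ZhuAlgebra V →ₗ[ℂ] ZhuAlgebra V →ₗ[ℂ] ZhuAlgebra V :=
  quotMul (zhuO V) (zhuMul V) zhuMul_mem_right zhuMul_mem_left

noncomputable instance : Mul (ZhuAlgebra V) := ⟨fun x y => mulLin V x y⟩

noncomputable instance : One (ZhuAlgebra V) := ⟨mk vac⟩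

theorem mul_def (x y : ZhuAlgebra V) : x * y = mulLin V x y := rfl

theorem mk_mul_mk (a b : V) : (mk a * mk b : ZhuAlgebra V) = mk (zhuMul V a b) := rfl

noncomputable instance : Ring (ZhuAlgebra V) where
  __ := (inferInstance : AddCommGroup (ZhuAlgebra V))
  left_distrib x y z := by simp only [mul_def, map_add]
  right_distrib x y z := by simp only [mul_def, map_add, LinearMap.add_apply]
  zero_mul x := by simp only [mul_def, map_zero, LinearMap.zero_apply]
  mul_zero x := by simp only [mul_def, map_zero]
  mul_assoc x y z := by
    obtain ⟨a, rfl⟩ := mk_surjective x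
    obtain ⟨b, rfl⟩ := mk_surjective y
    obtain ⟨c, rfl⟩ := mk_surjective z
    simp only [mk_mul_mk, mk_eq_mk]
    exact zhuMul_assoc_mem a b c
  one_mul x := by
    obtain ⟨a, rfl⟩ := mk_surjective x
    change mk (zhuMul V vac a) = mk a
    rw [vac_zhuMul]
  mul_one x := by
    obtain ⟨a, rfl⟩ := mk_surjective x
    change mk (zhuMul V a vac) = mk a
    rw [zhuMul_vac]

noncomputable instance : Algebra ℂ (ZhuAlgebra V) :=
  Algebra.ofModule (fun r x y => by simp only [mul_def, map_smul, LinearMap.smul_apply])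
    (fun r x y => by simp only [mul_def, map_smul])

end ZhuAlgebra

end Zhu

/-! ### The filtration of `A(V)` and the associated graded algebra -/

section Gr

variable (V) in
/-- `A(V)_n`, the image of `⨁_{i ≤ n} V_i` in `A(V)`. -/
noncomputable def zhuFil (n : ℕ) : Submodule ℂ (ZhuAlgebra V) :=
  (⨆ (i : ℕ) (_ : i ≤ n), wtSpace (V := V) i).map ZhuAlgebra.mk

variable (V) in
/-- `A(V)_{n-1}`, where `A(V)_{-1} = 0`. -/
noncomputable def zhuFilPred : ℕ → Submodule ℂ (ZhuAlgebra V)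
  | 0 => ⊥
  | n + 1 => zhuFil V n

theorem mk_mem_zhuFil {i n : ℕ} (hi : i ≤ n) {a : V} (ha : a ∈ wtSpace i) :
    ZhuAlgebra.mk a ∈ zhuFil V n :=
  Submodule.mem_map_of_mem (le_iSup₂_of_le (f := fun (i : ℕ) (_ : i ≤ n) => wtSpace (V := V) i)
    i hi le_rfl ha)

theorem one_mem_zhuFil : (1 : ZhuAlgebra V) ∈ zhuFil V 0 := mk_mem_zhuFil le_rfl vac_mem

theorem zhuFil_mul_le (m n : ℕ) : zhuFil V m * zhuFil V n ≤ zhuFil V (m + n) := by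
  have h : ∀ n, zhuFil V n = ⨆ (i : ℕ) (_ : i ≤ n), (wtSpace (V := V) i).map ZhuAlgebra.mk := by
    intro n; simp only [zhuFil, Submodule.map_iSup]
  rw [h m, h n]
  simp only [Submodule.iSup_mul, Submodule.mul_iSup, iSup_le_iff]
  intro j hj i hi
  rw [Submodule.mul_le]
  rintro _ ⟨a, ha, rfl⟩ _ ⟨b, hb, rfl⟩
  rw [ZhuAlgebra.mk_mul_mk, zhuMul_apply ha, zhuStar, LinearMap.sum_apply, LinearMap.sum_apply,
    map_sum]
  refine Submodule.sum_mem _ fun k hk => ?_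
  rw [Finset.mem_range] at hk
  rw [LinearMap.smul_apply, LinearMap.smul_apply, map_smul]
  refine Submodule.smul_mem _ _ (mk_mem_zhuFil (i := i + j - k) (by omega) (mode_mem ha hb ?_))
  omega

theorem mul_mem_zhuFil {m n : ℕ} {x y : ZhuAlgebra V} (hx : x ∈ zhuFil V m)
    (hy : y ∈ zhuFil V n) : x * y ∈ zhuFil V (m + n) :=
  zhuFil_mul_le m n (Submodule.mul_mem_mul hx hy)

theorem zhuFil_mono {m n : ℕ} (h : m ≤ n) : zhuFil V m ≤ zhuFil V n :=
  Submodule.map_mono (iSup₂_le fun i hi =>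
    le_iSup₂_of_le (f := fun (i : ℕ) (_ : i ≤ n) => wtSpace (V := V) i) i (hi.trans h) le_rfl)

theorem mul_mem_zhuFilPred_right {m n : ℕ} {x y : ZhuAlgebra V} (hx : x ∈ zhuFil V m)
    (hy : y ∈ zhuFilPred V n) : x * y ∈ zhuFilPred V (m + n) := by
  cases n with
  | zero =>
    rw [(Submodule.mem_bot ℂ).1 hy, mul_zero]; exact Submodule.zero_mem _
  | succ n => exact mul_mem_zhuFil hx hy

theorem mul_mem_zhuFilPred_left {m n : ℕ} {x y : ZhuAlgebra V} (hx : x ∈ zhuFilPred V m)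
    (hy : y ∈ zhuFil V n) : x * y ∈ zhuFilPred V (m + n) := by
  cases m with
  | zero =>
    rw [(Submodule.mem_bot ℂ).1 hx, zero_mul]; exact Submodule.zero_mem _
  | succ m =>
    rw [show m + 1 + n = m + n + 1 by omega]
    exact mul_mem_zhuFil (m := m) hx hy

variable (V) in
/-- The homogeneous piece `A(V)_n / A(V)_{n-1}` of `gr A(V)`. -/
def GrPiece (n : ℕ) : Type _ := zhuFil V n ⧸ (zhuFilPred V n).submoduleOf (zhuFil V n)

noncomputable instance (n : ℕ) : AddCommGroup (GrPiece V n) :=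
  inferInstanceAs (AddCommGroup (zhuFil V n ⧸ (zhuFilPred V n).submoduleOf (zhuFil V n)))

noncomputable instance (n : ℕ) : Module ℂ (GrPiece V n) :=
  inferInstanceAs (Module ℂ (zhuFil V n ⧸ (zhuFilPred V n).submoduleOf (zhuFil V n)))

namespace GrPiece

/-- The class in `A(V)_n / A(V)_{n-1}` of an element of `A(V)_n`. -/
noncomputable def mk (n : ℕ) : zhuFil V n →ₗ[ℂ] GrPiece V n :=
  ((zhuFilPred V n).submoduleOf (zhuFil V n)).mkQ

theorem mk_surjective (n : ℕ) : Function.Surjective (mk (V := V) n) :=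
  Submodule.mkQ_surjective _

/-- The product `x̄ · ȳ = \overline{x y}` of the pieces of `gr A(V)`. -/
noncomputable def mulLin (m n : ℕ) : GrPiece V m →ₗ[ℂ] GrPiece V n →ₗ[ℂ] GrPiece V (m + n) :=
  Submodule.liftQ _
    { toFun := fun x => Submodule.mapQ _ ((zhuFilPred V (m + n)).submoduleOf (zhuFil V (m + n)))
        (((LinearMap.mul ℂ (ZhuAlgebra V) x.1).restrict
          fun y (hy : y ∈ zhuFil V n) => mul_mem_zhuFil x.2 hy))
        (fun y hy => mul_mem_zhuFilPred_right x.2 hy)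
      map_add' := fun x y => by
        refine Submodule.linearMap_qext _ (LinearMap.ext fun z => ?_)
        exact congrArg (mk (m + n)) (Subtype.ext (add_mul x.1 y.1 z.1))
      map_smul' := fun r x => by
        refine Submodule.linearMap_qext _ (LinearMap.ext fun z => ?_)
        exact congrArg (mk (m + n)) (Subtype.ext (smul_mul_assoc r x.1 z.1)) }
    (fun x hx => by
      rw [LinearMap.mem_ker]
      refine Submodule.linearMap_qext _ (LinearMap.ext fun y => ?_)
      exact (Submodule.Quotient.mk_eq_zero _).2 (mul_mem_zhuFilPred_left hx y.2))

theorem mulLin_mk (m n : ℕ) (x : zhuFil V m) (y : zhuFil V n) :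
    mulLin m n (mk m x) (mk n y) = mk (m + n) ⟨x.1 * y.1, mul_mem_zhuFil x.2 y.2⟩ := rfl

theorem gradedMonoid_ext {m n : ℕ} (h : m = n) (x : zhuFil V m) (y : zhuFil V n)
    (hxy : x.1 = y.1) :
    (GradedMonoid.mk m (mk m x) : GradedMonoid (GrPiece V)) = GradedMonoid.mk n (mk n y) := by
  subst h
  rw [Subtype.ext hxy]

noncomputable instance : GradedMonoid.GMul (GrPiece V) := ⟨fun {m n} x y => mulLin m n x y⟩

noncomputable instance : GradedMonoid.GOne (GrPiece V) := ⟨mk 0 ⟨1, one_mem_zhuFil⟩⟩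

noncomputable instance : GradedMonoid.GMonoid (GrPiece V) where
  one_mul := by
    rintro ⟨n, x⟩
    obtain ⟨x, rfl⟩ := mk_surjective n x
    exact gradedMonoid_ext (zero_add n) _ _ (one_mul x.1)
  mul_one := by
    rintro ⟨n, x⟩
    obtain ⟨x, rfl⟩ := mk_surjective n x
    exact gradedMonoid_ext (add_zero n) _ _ (mul_one x.1)
  mul_assoc := by
    rintro ⟨l, x⟩ ⟨m, y⟩ ⟨n, z⟩
    obtain ⟨x, rfl⟩ := mk_surjective l x
    obtain ⟨y, rfl⟩ := mk_surjective m y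
    obtain ⟨z, rfl⟩ := mk_surjective n z
    exact gradedMonoid_ext (add_assoc l m n) _ _ (mul_assoc x.1 y.1 z.1)

noncomputable instance : DirectSum.GRing (GrPiece V) where
  mul_zero x := map_zero (mulLin _ _ x)
  zero_mul y := by
    change mulLin _ _ 0 y = 0
    rw [map_zero, LinearMap.zero_apply]
  mul_add x y z := map_add (mulLin _ _ x) y z
  add_mul x y z := by
    change mulLin _ _ (x + y) z = mulLin _ _ x z + mulLin _ _ y z
    rw [map_add, LinearMap.add_apply]
  natCast n := n • GradedMonoid.GOne.one
  natCast_zero := zero_smul _ _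
  natCast_succ n := succ_nsmul _ _
  intCast n := n • GradedMonoid.GOne.one
  intCast_ofNat n := natCast_zsmul _ _
  intCast_negSucc_ofNat n := negSucc_zsmul _ _

noncomputable instance : DirectSum.GAlgebra ℂ (GrPiece V) where
  toFun := (LinearMap.toSpanSingleton ℂ (GrPiece V 0) GradedMonoid.GOne.one).toAddMonoidHom
  map_one := one_smul ℂ (GradedMonoid.GOne.one : GrPiece V 0)
  map_mul r s := gradedMonoid_ext (V := V) (m := 0) (n := 0) rfl
    ((r * s) • ⟨1, one_mem_zhuFil⟩) ⟨(r • 1) * (s • 1), mul_mem_zhuFil (m := 0) (n := 0)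
      (Submodule.smul_mem _ _ one_mem_zhuFil) (Submodule.smul_mem _ _ one_mem_zhuFil)⟩
    (by simp [smul_smul, mul_comm])
  commutes := by
    rintro r ⟨n, x⟩
    obtain ⟨x, rfl⟩ := mk_surjective n x
    exact gradedMonoid_ext (by omega)
      ⟨(r • 1) * x.1, mul_mem_zhuFil (Submodule.smul_mem _ _ one_mem_zhuFil) x.2⟩
      ⟨x.1 * (r • 1), mul_mem_zhuFil x.2 (Submodule.smul_mem _ _ one_mem_zhuFil)⟩ (by simp)
  smul_def := by
    rintro r ⟨n, x⟩
    obtain ⟨x, rfl⟩ := mk_surjective n x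
    exact gradedMonoid_ext (by omega) (r • x)
      ⟨(r • 1) * x.1, mul_mem_zhuFil (Submodule.smul_mem _ _ one_mem_zhuFil) x.2⟩ (by simp)

end GrPiece

variable (V) in
/-- The associated graded algebra `gr A(V) = ⨁_n A(V)_n / A(V)_{n-1}`. -/
abbrev GrZhu : Type _ := ⨁ n, GrPiece V n

/-- For `x ∈ V_n`, the class `x̄ ∈ A(V)_n / A(V)_{n-1} ⊆ gr A(V)`. -/
noncomputable def grClass (n : ℕ) (x : wtSpace (V := V) n) : GrZhu V :=
  DirectSum.of (GrPiece V) n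
    (GrPiece.mk n ⟨ZhuAlgebra.mk (x : V), mk_mem_zhuFil le_rfl x.2⟩)

end Gr

end VertexOperatorAlgebra

open VertexOperatorAlgebra

/-! For `a ∈ V_p` and `b ∈ V_q`, the `j`-th term of `∑_j (p choose j) a_{j-d} b` has weight
`p + q + d - 1 - j`, so modulo lower filtration degree only the leading term `a_{-d} b` survives.
For `d = 1` the sum is `a ∗ b`, so the product of the classes of `a` and `b` in `gr A(V)` is the
class of `a_{-1} b`.  For `d = 2` the sum lies in `O(V)`, so the class of `a_{-2} b` vanishes, and
`x ↦ x̄` factors through `V / C₂(V)`.  It is onto because `A(V)_n` is spanned by the image of `V_n`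
and `A(V)_{n-1}`, and `gr A(V)` inherits commutativity from `V / C₂(V)`. -/

namespace VertexOperatorAlgebra

variable {V : Type*} [AddCommGroup V] [Module ℂ V] [VertexOperatorAlgebra V]

section Ext

variable {W : Type*} [AddCommMonoid W] [Module ℂ W]

theorem linearMap_ext_wtSpace {f g : V →ₗ[ℂ] W} (h : ∀ n, ∀ a ∈ wtSpace n, f a = g a) : f = g :=
  LinearMap.ext fun a => wtSpace_induction (P := fun a => f a = g a) a h (by simp only [map_zero])
    fun _ _ hx hy => by simp only [map_add, hx, hy]

theorem linearMap_ext_wtSpace₂ {f g : V →ₗ[ℂ] V →ₗ[ℂ] W}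
    (h : ∀ m n, ∀ a ∈ wtSpace m, ∀ b ∈ wtSpace n, f a b = g a b) : f = g :=
  linearMap_ext_wtSpace fun m a ha => linearMap_ext_wtSpace fun n => h m n a ha

end Ext

theorem zhuFil_eq_map_sup_zhuFilPred (n : ℕ) :
    zhuFil V n = (wtSpace n).map ZhuAlgebra.mk ⊔ zhuFilPred V n := by
  cases n with
  | zero => simp only [zhuFil, zhuFilPred, nonpos_iff_eq_zero, iSup_iSup_eq_left, sup_bot_eq]
  | succ n => rw [zhuFil, Nat.iSup_le_succ, Submodule.map_sup, sup_comm, zhuFilPred, zhuFil]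

theorem mk_mem_zhuFilPred {i n : ℕ} (hi : i < n) {a : V} (ha : a ∈ wtSpace i) :
    ZhuAlgebra.mk a ∈ zhuFilPred V n := by
  cases n with
  | zero => exact absurd hi i.not_lt_zero
  | succ n => exact mk_mem_zhuFil (Nat.le_of_lt_succ hi) ha

theorem mk_mode_mem_zhuFilPred {p q k : ℕ} {a b : V} (ha : a ∈ wtSpace p) (hb : b ∈ wtSpace q)
    {n : ℤ} (hk : p + q - n - 1 < k) : ZhuAlgebra.mk (mode n a b) ∈ zhuFilPred V k := by
  rcases lt_or_ge ((p : ℤ) + q - n - 1) 0 with hneg | hnonneg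
  · rw [mode_eq_zero ha hb hneg, map_zero]
    exact Submodule.zero_mem _
  · exact mk_mem_zhuFilPred (by omega) (mode_mem ha hb (Int.toNat_of_nonneg hnonneg))

theorem mk_sum_mode_sub_leading_mem_zhuFilPred {p q k : ℕ} {a b : V} (ha : a ∈ wtSpace p)
    (hb : b ∈ wtSpace q) {d : ℤ} (hk : k + 1 = p + q + d) (c : ℕ → ℂ) (N : ℕ) :
    ZhuAlgebra.mk (∑ j ∈ Finset.range (N + 1), c j • mode (j - d) a b) -
      c 0 • ZhuAlgebra.mk (mode (-d) a b) ∈ zhuFilPred V k := by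
  rw [Finset.sum_range_succ', Nat.cast_zero, zero_sub, map_add, map_smul, add_sub_cancel_right,
    map_sum]
  refine Submodule.sum_mem _ fun j _ => ?_
  rw [map_smul]
  exact Submodule.smul_mem _ _ (mk_mode_mem_zhuFilPred ha hb (by omega))

theorem mk_zhuStar_sub_mk_mode_neg_one_mem_zhuFilPred {p q : ℕ} {a b : V} (ha : a ∈ wtSpace p)
    (hb : b ∈ wtSpace q) :
    ZhuAlgebra.mk (zhuStar p a b) - ZhuAlgebra.mk (mode (-1) a b) ∈ zhuFilPred V (p + q) := by
  simpa [zhuStar] using mk_sum_mode_sub_leading_mem_zhuFilPred ha hb (k := p + q) (d := 1)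
    (by push_cast; ring) (fun j => (p.choose j : ℂ)) p

theorem mk_zhuCirc_eq_zero {p : ℕ} {a : V} (ha : a ∈ wtSpace p) (b : V) :
    ZhuAlgebra.mk (zhuCirc p a b) = 0 :=
  (Submodule.Quotient.mk_eq_zero (zhuO V)).2 (Submodule.subset_span ⟨p, a, ha, b, rfl⟩)

theorem mk_mode_neg_two_mem_zhuFilPred {p q : ℕ} {a b : V} (ha : a ∈ wtSpace p)
    (hb : b ∈ wtSpace q) : ZhuAlgebra.mk (mode (-2) a b) ∈ zhuFilPred V (p + q + 1) := by
  have hsub : ZhuAlgebra.mk (zhuCirc p a b) - ZhuAlgebra.mk (mode (-2) a b) ∈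
      zhuFilPred V (p + q + 1) := by
    simpa [zhuCirc] using mk_sum_mode_sub_leading_mem_zhuFilPred ha hb (k := p + q + 1) (d := 2)
      (by push_cast; ring) (fun j => (p.choose j : ℂ)) p
  rwa [mk_zhuCirc_eq_zero ha, zero_sub, Submodule.neg_mem_iff] at hsub

namespace GrPiece

theorem mk_eq_mk {n : ℕ} {x y : zhuFil V n} :
    mk n x = mk n y ↔ (x : ZhuAlgebra V) - y ∈ zhuFilPred V n :=
  Submodule.Quotient.eq _

theorem mk_eq_zero {n : ℕ} {x : zhuFil V n} :
    mk n x = 0 ↔ (x : ZhuAlgebra V) ∈ zhuFilPred V n :=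
  Submodule.Quotient.mk_eq_zero _

end GrPiece

theorem exists_grClass_eq_of (n : ℕ) (s : GrPiece V n) :
    ∃ x : wtSpace (V := V) n, grClass n x = DirectSum.of (GrPiece V) n s := by
  obtain ⟨⟨y, hy⟩, rfl⟩ := GrPiece.mk_surjective n s
  rw [zhuFil_eq_map_sup_zhuFilPred] at hy
  obtain ⟨_, ⟨x, hx, rfl⟩, z, hz, rfl⟩ := Submodule.mem_sup.1 hy
  refine ⟨⟨x, hx⟩, congrArg _ (GrPiece.mk_eq_mk.2 ?_)⟩
  rwa [sub_add_cancel_left, Submodule.neg_mem_iff]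

theorem grClass_mul_grClass (m n : ℕ) (a : wtSpace (V := V) m) (b : wtSpace (V := V) n) :
    grClass m a * grClass n b =
      grClass (m + n) ⟨mode (-1) (a : V) (b : V), mode_neg_one_mem a.2 b.2⟩ := by
  rw [grClass, grClass, grClass, DirectSum.of_mul_of]
  refine congrArg _ (GrPiece.mk_eq_mk.2 ?_)
  change ZhuAlgebra.mk (zhuMul V a b) - ZhuAlgebra.mk (mode (-1) (a : V) (b : V)) ∈ _
  rw [zhuMul_apply a.2]
  exact mk_zhuStar_sub_mk_mode_neg_one_mem_zhuFilPred a.2 b.2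

variable (V) in
/-- The linear extension to `V` of the maps `V_n → gr A(V)`, `x ↦ x̄`, defined through the
decomposition `V = ⨁_n V_n`. -/
noncomputable def toGrZhu : V →ₗ[ℂ] GrZhu V :=
  DirectSum.toModule ℂ ℕ (GrZhu V) (fun n =>
      DirectSum.lof ℂ ℕ (GrPiece V) n ∘ₗ GrPiece.mk n ∘ₗ
        (ZhuAlgebra.mk.restrict fun _ hx => mk_mem_zhuFil le_rfl hx)) ∘ₗ
    (LinearEquiv.ofBijective (DirectSum.coeLinearMap (wtSpace (V := V)))
      isInternal_wtSpace).symm.toLinearMap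

theorem toGrZhu_of_mem {n : ℕ} {x : V} (hx : x ∈ wtSpace n) : toGrZhu V x = grClass n ⟨x, hx⟩ := by
  have hdecomp : (LinearEquiv.ofBijective (DirectSum.coeLinearMap (wtSpace (V := V)))
      isInternal_wtSpace).symm x = DirectSum.lof ℂ ℕ (fun n => wtSpace (V := V) n) n ⟨x, hx⟩ := by
    rw [LinearEquiv.symm_apply_eq]
    exact (DirectSum.coeLinearMap_lof (wtSpace (V := V)) n ⟨x, hx⟩).symm
  rw [toGrZhu, LinearMap.comp_apply, LinearEquiv.coe_coe, hdecomp, DirectSum.toModule_lof]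
  rfl

theorem toGrZhu_mode_neg_one (a b : V) :
    toGrZhu V (mode (-1) a b) = toGrZhu V a * toGrZhu V b := by
  have hbilin : (mode (-1)).compr₂ (toGrZhu V) =
      (LinearMap.mul ℂ (GrZhu V)).compl₁₂ (toGrZhu V) (toGrZhu V) :=
    linearMap_ext_wtSpace₂ fun m n a ha b hb => by
      rw [LinearMap.compr₂_apply, LinearMap.compl₁₂_apply, LinearMap.mul_apply',
        toGrZhu_of_mem ha, toGrZhu_of_mem hb, grClass_mul_grClass,
        toGrZhu_of_mem (mode_neg_one_mem ha hb)]
  exact LinearMap.congr_fun₂ hbilin a b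

theorem toGrZhu_mode_neg_two (a b : V) : toGrZhu V (mode (-2) a b) = 0 := by
  have hbilin : (mode (-2)).compr₂ (toGrZhu V) = 0 :=
    linearMap_ext_wtSpace₂ fun p q a ha b hb => by
      have hwt : mode (-2) a b ∈ wtSpace (p + q + 1) := mode_mem ha hb (by push_cast; ring)
      rw [LinearMap.compr₂_apply, toGrZhu_of_mem hwt, grClass,
        GrPiece.mk_eq_zero.2 (mk_mode_neg_two_mem_zhuFilPred ha hb), map_zero,
        LinearMap.zero_apply, LinearMap.zero_apply]
  exact LinearMap.congr_fun₂ hbilin a b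

theorem C2_le_ker_toGrZhu : C2 V ≤ LinearMap.ker (toGrZhu V) := by
  refine Submodule.span_le.2 ?_
  rintro _ ⟨a, b, rfl⟩
  exact toGrZhu_mode_neg_two a b

theorem toGrZhu_surjective : Function.Surjective (toGrZhu V) := by
  rw [← LinearMap.range_eq_top, eq_top_iff]
  rintro s -
  induction s using DirectSum.induction_on with
  | zero => exact Submodule.zero_mem _
  | add s t hs ht => exact Submodule.add_mem _ hs ht
  | of n s =>
    obtain ⟨x, hx⟩ := exists_grClass_eq_of n s
    exact ⟨x, (toGrZhu_of_mem x.2).trans hx⟩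

namespace C2Algebra

variable (V) in
/-- The homomorphism `φ : V / C₂(V) → gr A(V)` induced by `x ↦ x̄` for homogeneous `x`. -/
noncomputable def toGrZhu : C2Algebra V →ₐ[ℂ] GrZhu V :=
  AlgHom.ofLinearMap ((C2 V).liftQ (VertexOperatorAlgebra.toGrZhu V) C2_le_ker_toGrZhu)
    (toGrZhu_of_mem vac_mem) <|
    mk_surjective.forall₂.2 toGrZhu_mode_neg_one

theorem toGrZhu_mk (a : V) : toGrZhu V (mk a) = VertexOperatorAlgebra.toGrZhu V a := rfl

theorem toGrZhu_surjective : Function.Surjective (toGrZhu V) :=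
  Function.Surjective.of_comp (g := mk) VertexOperatorAlgebra.toGrZhu_surjective

end C2Algebra

theorem grZhu_mul_comm (s t : GrZhu V) : s * t = t * s := by
  obtain ⟨x, rfl⟩ := C2Algebra.toGrZhu_surjective s
  obtain ⟨y, rfl⟩ := C2Algebra.toGrZhu_surjective t
  rw [← map_mul, mul_comm, map_mul]

end VertexOperatorAlgebra

theorem proposition3p3 {V : Type*} [AddCommGroup V] [Module ℂ V] [VertexOperatorAlgebra V] :
    (∀ s t : GrZhu V, s * t = t * s) ∧
    (∀ (m n : ℕ) (a : wtSpace (V := V) m) (b : wtSpace (V := V) n),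
      grClass m a * grClass n b =
        grClass (m + n) ⟨mode (-1) (a : V) (b : V), mode_neg_one_mem a.2 b.2⟩) ∧
    ∃ φ : C2Algebra V →ₐ[ℂ] GrZhu V,
      Function.Surjective φ ∧
      ∀ (n : ℕ) (x : wtSpace (V := V) n), φ (C2Algebra.mk (x : V)) = grClass n x :=
  ⟨grZhu_mul_comm, grClass_mul_grClass, C2Algebra.toGrZhu V, C2Algebra.toGrZhu_surjective,
    fun _ x => (C2Algebra.toGrZhu_mk (x : V)).trans (toGrZhu_of_mem x.2)⟩
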